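/- For $\tau$ in the complex upper half-plane put $q=e^{2\pi i\tau}$ and $$E_2(\tau)=1-24\sum_{n\ge1}\sigma_1(n)q^n,\qquad E_4(\tau)=1+240\sum_{n\ge1}\sigma_3(n)q^n,\qquad \Delta(\tau)=q\prod_{n\ge1}(1-q^n)^{24},\qquad j(\tau)=\frac{E_4(\tau)^3}{\Delta(\tau)},$$ where $\sigma_k(n)=\sum_{d\mid n}d^k$. For $f,g\in\mathbb{C}[j(\tau)]$ let the Atkin inner product be $$(f,g)=\text{the constant term of } f\,g\,E_2 \text{ as a Laurent series in } q .$$ Let $\mu$ be the Möbius function and let $$\mathcal{F}_1(t)={}_2F_1\left(\tfrac1{12},\tfrac5{12};1;1728\,t\right)=\sum_{n\ge0}\frac{(1/12)_n(5/12)_n}{(1)_n\,n!}\,(1728\,t)^n\in\mathbb{C}[[t]],$$ where $(a)_0=1$ and $(a)_n=a(a+1)\cdots(a+n-1)$ for $n\ge1$. Then the following two identities hold in $\mathbb{C}[[t]]$: $$\mathcal{F}_1(t)=\prod_{n=1}^{\infty}(1-t^n)^{-c(n)},\qquad c(n)=\frac1{12n}\sum_{d\mid n}\mu\left(\tfrac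 nd\right)(j^d,1),$$ $$\mathcal{F}_1(t)=\exp\left(\sum_{m=1}^{\infty}\frac1{12}\,(j^m,1)\,\frac{t^m}{m}\right).$$ Here $(1-t^n)^{a}=\sum_{k\ge0}\binom{a}{k}(-t^n)^k$ for $a\in\mathbb{C}$, and the infinite product converges $t$-adically. -/

import Mathlib

open Filter Complex UpperHalfPlane
open scoped Topology PowerSeries LaurentSeries MatrixGroups

noncomputable section

namespace AtkinProduct

/-- The elliptic modular function `j = E₄ ^ 3 / Δ` on the upper half-plane. -/
def jFun : ℍ → ℂ := fun τ => ModularForm.E₄ τ ^ 3 / ModularForm.discriminant τ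

/-- `L` is the Laurent expansion of `F` in `q = exp (2 π i τ)` (with finite principal part):
for every `τ` the series `∑ L_n q ^ n` over the integers converges to `F τ`. -/
def HasLaurentExpansion (F : ℍ → ℂ) (L : ℂ⸨X⸩) : Prop :=
  ∀ τ : ℍ, HasSum (fun n : ℤ => L.coeff n * Function.Periodic.qParam 1 (τ : ℂ) ^ n) (F τ)

open Classical in
/-- The constant term of the Laurent expansion in `q` of a function on the upper half-plane
(and `0` if there is no such expansion). -/
def constantTerm (F : ℍ → ℂ) : ℂ :=
  if h : ∃ L : ℂ⸨X⸩, HasLaurentExpansion F L then h.choose.coeff 0 else 0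

/-- The algebra `ℂ[j(τ)]` of polynomials in the modular function `j`. -/
abbrev PolyJ : Subalgebra ℂ (ℍ → ℂ) := Algebra.adjoin ℂ {jFun}

/-- The function `j` as an element of `ℂ[j(τ)]`. -/
def jElt : PolyJ := ⟨jFun, Algebra.self_mem_adjoin_singleton ℂ jFun⟩

/-- The Atkin inner product on `ℂ[j(τ)]`: the constant term of `f g E₂` as a Laurent series
in `q`. -/
def atkinInner (f g : PolyJ) : ℂ :=
  constantTerm ((f : ℍ → ℂ) * (g : ℍ → ℂ) * EisensteinSeries.E2)

/-- The Gauss hypergeometric series `₂F₁(a, b; c; z)` as a formal power series in `z`. -/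
def hypergeometric (a b c : ℂ) : ℂ⟦X⟧ :=
  PowerSeries.mk (ordinaryHypergeometricCoefficient a b c)

/-- `𝓕₁(t) = ₂F₁(1/12, 5/12; 1; 1728 t)` as a formal power series in `t`. -/
def F₁ : ℂ⟦X⟧ := PowerSeries.rescale 1728 (hypergeometric (1 / 12) (5 / 12) 1)

/-- `(1 - t ^ n) ^ a = ∑ k, (a choose k) (-t ^ n) ^ k` as a formal power series in `t`. -/
def oneSubPow (n : ℕ+) (a : ℂ) : ℂ⟦X⟧ :=
  (PowerSeries.binomialSeries ℂ a).subst (-(PowerSeries.X ^ (n : ℕ)) : ℂ⟦X⟧)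

/-- The formal infinite product `∏ i, f i` converges (unconditionally, for the `t`-adic topology)
to `g`: each coefficient of the finite subproducts is eventually that of `g`. -/
def HasFormalProd {ι : Type*} (f : ι → ℂ⟦X⟧) (g : ℂ⟦X⟧) : Prop :=
  ∀ d : ℕ, ∀ᶠ s : Finset ι in atTop,
    PowerSeries.coeff d (∏ i ∈ s, f i) = PowerSeries.coeff d g

/-- The exponent `c(n) = 1 / (12 n) * ∑_{d ∣ n} μ(n / d) (j ^ d, 1)`. -/
def atkinExponent (n : ℕ+) : ℂ :=
  1 / (12 * (n : ℂ)) * ∑ d ∈ (n : ℕ).divisors,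
    (ArithmeticFunction.moebius ((n : ℕ) / d) : ℂ) * atkinInner (jElt ^ d) 1

/-! ### The constant term is well defined -/

local notation "𝕢" => Function.Periodic.qParam

theorem q_ne_zero (τ : ℍ) : 𝕢 1 (τ : ℂ) ≠ 0 := Function.Periodic.qParam_ne_zero _

theorem hasLaurentExpansion_single_mul_iff (F : ℍ → ℂ) (N : ℤ) (p : ℂ⟦X⟧) :
    HasLaurentExpansion F (HahnSeries.single N (1 : ℂ) * (p : ℂ⸨X⸩)) ↔
      ∀ τ : ℍ, HasSum (fun n : ℕ => p.coeff n * 𝕢 1 (τ : ℂ) ^ n) (F τ * 𝕢 1 (τ : ℂ) ^ (-N)) := by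
  refine forall_congr' fun τ => ?_
  have hq := q_ne_zero τ
  have hinj : Function.Injective (fun n : ℕ => (n : ℤ) + N) := fun a b h => by
    simpa using h
  rw [← hinj.hasSum_iff]
  · have h1 : ((fun n : ℤ => (HahnSeries.single N (1 : ℂ) * (p : ℂ⸨X⸩)).coeff n *
        𝕢 1 (τ : ℂ) ^ n) ∘ fun n : ℕ => (n : ℤ) + N) =
        fun n : ℕ => (p.coeff n * 𝕢 1 (τ : ℂ) ^ n) * 𝕢 1 (τ : ℂ) ^ N := by
      funext n
      simp only [Function.comp_apply]
      rw [HahnSeries.coeff_single_mul_add, LaurentSeries.coeff_coe_powerSeries, zpow_add₀ hq,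
        zpow_natCast]
      ring
    rw [h1]
    constructor
    · intro h
      convert! h.mul_right (𝕢 1 (τ : ℂ) ^ (-N)) using 1
      funext n
      rw [mul_assoc, ← zpow_add₀ hq]; simp
    · intro h
      convert! h.mul_right (𝕢 1 (τ : ℂ) ^ N) using 1
      rw [mul_assoc, ← zpow_add₀ hq]; simp
  · intro n hn
    have hneg : n - N < 0 := by
      by_contra hcon
      exact hn ⟨(n - N).toNat, by simp only; omega⟩
    have h2 := HahnSeries.coeff_single_mul_add (r := (1 : ℂ)) (x := (p : ℂ⸨X⸩)) (a := n - N) (b := N)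
    rw [sub_add_cancel] at h2
    rw [h2, PowerSeries.coeff_coe, if_pos hneg]
    simp

theorem HasLaurentExpansion.mul {F G : ℍ → ℂ} {L M : ℂ⸨X⸩} (hF : HasLaurentExpansion F L)
    (hG : HasLaurentExpansion G M) : HasLaurentExpansion (F * G) (L * M) := by
  rw [← LaurentSeries.single_order_mul_powerSeriesPart L,
    hasLaurentExpansion_single_mul_iff] at hF
  rw [← LaurentSeries.single_order_mul_powerSeriesPart M,
    hasLaurentExpansion_single_mul_iff] at hG
  have hLM : L * M = HahnSeries.single (L.order + M.order) (1 : ℂ) *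
      ((L.powerSeriesPart * M.powerSeriesPart : ℂ⟦X⟧) : ℂ⸨X⸩) := by
    conv_lhs => rw [← LaurentSeries.single_order_mul_powerSeriesPart L,
      ← LaurentSeries.single_order_mul_powerSeriesPart M]
    have : HahnSeries.single (L.order + M.order) (1 : ℂ) =
      HahnSeries.single L.order (1 : ℂ) * HahnSeries.single M.order 1 := by simp
    rw [PowerSeries.coe_mul, this]
    ring
  rw [hLM, hasLaurentExpansion_single_mul_iff]
  intro τ
  have h1 := (hF τ).summable.norm
  have h2 := (hG τ).summable.norm
  have h3 := tsum_mul_tsum_eq_tsum_sum_antidiagonal_of_summable_norm h1 h2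
  have h4 := (summable_norm_sum_mul_antidiagonal_of_summable_norm h1 h2).of_norm.hasSum
  rw [← h3, (hF τ).tsum_eq, (hG τ).tsum_eq] at h4
  convert! h4 using 1
  · funext n
    rw [PowerSeries.coeff_mul, Finset.sum_mul]
    refine Finset.sum_congr rfl fun x hx => ?_
    rw [← Finset.HasAntidiagonal.mem_antidiagonal.mp hx, pow_add]
    ring
  · rw [neg_add, zpow_add₀ (q_ne_zero τ), Pi.mul_apply]
    ring

theorem HasLaurentExpansion.add {F G : ℍ → ℂ} {L M : ℂ⸨X⸩} (hF : HasLaurentExpansion F L)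
    (hG : HasLaurentExpansion G M) : HasLaurentExpansion (F + G) (L + M) := fun τ => by
  simpa [add_mul] using (hF τ).add (hG τ)

theorem hasLaurentExpansion_of_hasSum {F : ℍ → ℂ} {p : ℂ⟦X⟧}
    (h : ∀ τ : ℍ, HasSum (fun n : ℕ => p.coeff n * 𝕢 1 (τ : ℂ) ^ n) (F τ)) :
    HasLaurentExpansion F (p : ℂ⸨X⸩) := by
  have := (hasLaurentExpansion_single_mul_iff F 0 p).mpr (by simpa using h)
  simpa using this

/-- A function has at most one Laurent expansion in `q`. -/
theorem HasLaurentExpansion.unique {F : ℍ → ℂ} {L M : ℂ⸨X⸩} (hL : HasLaurentExpansion F L)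
    (hM : HasLaurentExpansion F M) : L = M := by
  have hD : HasLaurentExpansion 0 (L - M) := fun τ => by
    simpa [sub_mul] using (hL τ).sub (hM τ)
  rw [← LaurentSeries.single_order_mul_powerSeriesPart (L - M),
    hasLaurentExpansion_single_mul_iff] at hD
  have hz : ∀ m, (L - M).powerSeriesPart.coeff m = 0 := fun m => by
    have := ModularFormClass.qExpansion_coeff_unique (f := (0 : ModularForm 𝒮ℒ 0)) one_pos
      one_mem_strictPeriods_SL (c := fun n => (L - M).powerSeriesPart.coeff n)
      (fun τ => by simpa only [Pi.zero_apply, zero_mul, smul_eq_mul] using! hD τ) m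
    rw [this, FunLike.coe_zero, qExpansion_zero, map_zero]
  have : (L - M).powerSeriesPart = 0 := PowerSeries.ext (by simpa using hz)
  rw [LaurentSeries.powerSeriesPart_eq_zero] at this
  exact sub_eq_zero.mp this

theorem HasLaurentExpansion.constantTerm_eq {F : ℍ → ℂ} {L : ℂ⸨X⸩}
    (h : HasLaurentExpansion F L) : constantTerm F = L.coeff 0 := by
  have h' : ∃ L : ℂ⸨X⸩, HasLaurentExpansion F L := ⟨L, h⟩
  rw [constantTerm, dif_pos h', h'.choose_spec.unique h]

theorem hasLaurentExpansion_E2 : HasLaurentExpansion EisensteinSeries.E2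
    ((PowerSeries.mk fun m => if m = 0 then 1 else -24 * (ArithmeticFunction.sigma 1 m : ℂ) :
      ℂ⟦X⟧) : ℂ⸨X⸩) :=
  hasLaurentExpansion_of_hasSum fun τ => by
    simpa [Function.Periodic.qParam] using EisensteinSeries.hasSum_qExpansion_E2 (z := τ)

theorem hasLaurentExpansion_E₄ : HasLaurentExpansion ModularForm.E₄
    (qExpansion 1 ModularForm.E₄ : ℂ⸨X⸩) :=
  hasLaurentExpansion_of_hasSum fun τ =>
    ModularForm.hasSum_qExpansion ModularForm.E₄ one_pos one_mem_strictPeriods_SL τ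

/-- The function `1 / Δ` has a Laurent expansion in `q`. -/
theorem exists_hasLaurentExpansion_inv_discriminant :
    ∃ L : ℂ⸨X⸩, HasLaurentExpansion (fun τ => (ModularForm.discriminant τ)⁻¹) L := by
  have key : ∀ τ : ℍ, ModularForm.discriminant τ =
      𝕢 1 (τ : ℂ) * ∏' n : ℕ, (1 - 𝕢 1 (τ : ℂ) ^ (n + 1)) ^ 24 := fun τ => by
    have hq : ‖𝕢 1 (τ : ℂ)‖ < 1 := Function.Periodic.norm_qParam_lt_one one_pos τ.im_pos
    exact (SlashInvariantFormClass.eq_cuspFunction CuspForm.discriminant τ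
      one_mem_strictPeriods_SL one_ne_zero).symm.trans
      (ModularForm.discriminant_cuspFunction_eqOn (by simpa using hq))
  have hd : DifferentiableOn ℂ (fun q : ℂ => (∏' n : ℕ, (1 - q ^ (n + 1)) ^ 24)⁻¹)
      (Metric.ball 0 1) := by
    refine (ModularForm.differentiableOn_tprod_one_sub_pow_pow 24).fun_inv fun q hq => ?_
    by_cases hq0 : q = 0
    · simp [hq0]
    · have him := Function.Periodic.im_invQParam_pos_of_norm_lt_one one_pos (by simpa using hq) hq0
      have h := key ⟨_, him⟩
      intro h0
      simp only [Function.Periodic.qParam_right_inv one_ne_zero hq0, h0, mul_zero] at h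
      exact ModularForm.discriminant_ne_zero _ h
  refine ⟨HahnSeries.single (-1) (1 : ℂ) * ((PowerSeries.mk fun n => (n.factorial : ℂ)⁻¹ *
    iteratedDeriv n (fun q : ℂ => (∏' n : ℕ, (1 - q ^ (n + 1)) ^ 24)⁻¹) 0 : ℂ⟦X⟧) : ℂ⸨X⸩), ?_⟩
  rw [hasLaurentExpansion_single_mul_iff]
  intro τ
  have hq : ‖𝕢 1 (τ : ℂ)‖ < 1 := Function.Periodic.norm_qParam_lt_one one_pos τ.im_pos
  convert! Complex.hasSum_taylorSeries_on_ball hd (z := 𝕢 1 (τ : ℂ)) (by simpa using hq) using 1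
  · funext n
    simp only [PowerSeries.coeff_mk, smul_eq_mul, sub_zero]
    ring
  · rw [key]
    have := q_ne_zero τ
    simp only [neg_neg, zpow_one, mul_inv]
    field_simp

/-- The function `j` has a Laurent expansion in `q`. -/
theorem exists_hasLaurentExpansion_jFun : ∃ L : ℂ⸨X⸩, HasLaurentExpansion jFun L := by
  obtain ⟨L, hL⟩ := exists_hasLaurentExpansion_inv_discriminant
  have h := hasLaurentExpansion_E₄
  have h3 := ((h.mul h).mul h).mul hL
  have h5 : jFun = (ModularForm.E₄ * ModularForm.E₄ * ModularForm.E₄ *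
      fun τ => (ModularForm.discriminant τ)⁻¹ : ℍ → ℂ) := by
    funext τ
    simp only [jFun, Pi.mul_apply]
    ring
  exact h5 ▸ ⟨_, h3⟩

/-- Every element of `ℂ[j]` has a Laurent expansion in `q`, so that the constant term in the
Atkin inner product is never the default value. -/
theorem exists_hasLaurentExpansion_of_mem {f : ℍ → ℂ} (hf : f ∈ PolyJ) :
    ∃ L : ℂ⸨X⸩, HasLaurentExpansion f L := by
  induction hf using Algebra.adjoin_induction with
  | mem x hx => rw [Set.mem_singleton_iff.mp hx]; exact exists_hasLaurentExpansion_jFun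
  | algebraMap r =>
    refine ⟨((PowerSeries.C r : ℂ⟦X⟧) : ℂ⸨X⸩), hasLaurentExpansion_of_hasSum fun τ => ?_⟩
    convert! hasSum_single (f := fun n : ℕ => (PowerSeries.C r : ℂ⟦X⟧).coeff n * 𝕢 1 (τ : ℂ) ^ n)
      0 (fun n hn => by simp [PowerSeries.coeff_C, hn]) using 1
    simp
  | add x y _ _ hx hy =>
    obtain ⟨L, hL⟩ := hx
    obtain ⟨M, hM⟩ := hy
    exact ⟨_, hL.add hM⟩
  | mul x y _ _ hx hy =>
    obtain ⟨L, hL⟩ := hx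
    obtain ⟨M, hM⟩ := hy
    exact ⟨_, hL.mul hM⟩

theorem exists_hasLaurentExpansion_atkin (f g : PolyJ) :
    ∃ L : ℂ⸨X⸩, HasLaurentExpansion
      ((f : ℍ → ℂ) * (g : ℍ → ℂ) * EisensteinSeries.E2) L := by
  obtain ⟨L, hL⟩ := exists_hasLaurentExpansion_of_mem f.2
  obtain ⟨M, hM⟩ := exists_hasLaurentExpansion_of_mem g.2
  exact ⟨_, (hL.mul hM).mul hasLaurentExpansion_E2⟩

end AtkinProduct

end

open Filter Complex UpperHalfPlane
open scoped Topology PowerSeries LaurentSeries MatrixGroups ModularForm Manifold Derivative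

noncomputable section

namespace AtkinProduct

open PowerSeries (constantCoeff)

/-! Put t = 1/j, θ = q d/dq and v(t) = t F₁'(t)/F₁(t). Everything follows from (j^m, 1) = 12 [t^m] v
for m ≥ 1 (`atkinInner_eq`).

The second-order hypergeometric equation for F₁ becomes a Riccati equation for v
(`logDerivF₁_riccati`). Ramanujan's formulas for θE₂, θE₄, θE₆ show that (E₂E₄/E₆ - 1)/12, as a
function of t, solves the same equation (`E2_riccati`). A solution without constant term is unique
(`riccati_unique`), so E₂ = (E₆/E₄)(1 + 12 v(1/j)) (`logDerivF₁_subst`).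

Since θt/t = E₆/E₄, the constant term of j^m E₂ is the residue of t^(-m) (1 + 12 v(t)) dt/t, that
is, a coefficient of 12 v (`coeff_residue`).

Both identities are then compared with F₁ through logarithmic derivatives: a series is determined by
its constant term and by v. For the product, Möbius inversion supplies the exponents. -/

/-! ### Power series q-expansions and the operator q d/dq. -/

/-- `p` is the `q`-expansion of `F`: the series `∑ p_n q ^ n` converges to `F` on the upper
half-plane. -/
def HasQExpansion (F : ℍ → ℂ) (p : ℂ⟦X⟧) : Prop :=
  ∀ τ : ℍ, HasSum (fun n : ℕ => p.coeff n * Function.Periodic.qParam 1 (τ : ℂ) ^ n) (F τ)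

theorem hasQExpansion_iff_hasLaurentExpansion {F : ℍ → ℂ} {p : ℂ⟦X⟧} :
    HasQExpansion F p ↔ HasLaurentExpansion F (p : ℂ⸨X⸩) := by
  have := hasLaurentExpansion_single_mul_iff F 0 p
  simp only [HahnSeries.single_zero_one, one_mul, neg_zero, zpow_zero, mul_one] at this
  exact this.symm

theorem HasQExpansion.hasLaurentExpansion {F : ℍ → ℂ} {p : ℂ⟦X⟧} (h : HasQExpansion F p) :
    HasLaurentExpansion F (p : ℂ⸨X⸩) :=
  hasQExpansion_iff_hasLaurentExpansion.mp h

theorem HasQExpansion.mul {F G : ℍ → ℂ} {p r : ℂ⟦X⟧} (hF : HasQExpansion F p)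
    (hG : HasQExpansion G r) : HasQExpansion (F * G) (p * r) := by
  rw [hasQExpansion_iff_hasLaurentExpansion, PowerSeries.coe_mul]
  exact hF.hasLaurentExpansion.mul hG.hasLaurentExpansion

theorem HasQExpansion.add {F G : ℍ → ℂ} {p r : ℂ⟦X⟧} (hF : HasQExpansion F p)
    (hG : HasQExpansion G r) : HasQExpansion (F + G) (p + r) := fun τ => by
  simpa [add_mul] using (hF τ).add (hG τ)

theorem HasQExpansion.smul {F : ℍ → ℂ} {p : ℂ⟦X⟧} (c : ℂ) (hF : HasQExpansion F p) :
    HasQExpansion (c • F) (c • p) := fun τ => by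
  simpa [mul_assoc] using (hF τ).mul_left c

theorem HasQExpansion.sub {F G : ℍ → ℂ} {p r : ℂ⟦X⟧} (hF : HasQExpansion F p)
    (hG : HasQExpansion G r) : HasQExpansion (F - G) (p - r) := fun τ => by
  simpa [sub_mul] using (hF τ).sub (hG τ)

theorem HasQExpansion.unique {F : ℍ → ℂ} {p r : ℂ⟦X⟧} (hp : HasQExpansion F p)
    (hr : HasQExpansion F r) : p = r :=
  HahnSeries.ofPowerSeries_injective (hp.hasLaurentExpansion.unique hr.hasLaurentExpansion)

/-- The derivation `X d/dX` on power series. -/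
def theta : Derivation ℂ ℂ⟦X⟧ ℂ⟦X⟧ := (PowerSeries.X : ℂ⟦X⟧) • PowerSeries.derivative ℂ

theorem theta_apply (p : ℂ⟦X⟧) : theta p = PowerSeries.X * PowerSeries.derivative ℂ p := rfl

theorem coeff_theta (p : ℂ⟦X⟧) (n : ℕ) : (theta p).coeff n = n * p.coeff n := by
  rw [theta_apply]
  cases n with
  | zero => simp
  | succ n => rw [PowerSeries.coeff_succ_X_mul, PowerSeries.coeff_derivative]; push_cast; ring

/-- Termwise differentiation: |q| decreases with the imaginary part, so for Im w > Im τ / 2 the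
terms are dominated by those at the point `σ` of height Im τ / 2, where the series converges
absolutely. -/
theorem HasQExpansion.derivative {F : ℍ → ℂ} {p : ℂ⟦X⟧} (h : HasQExpansion F p) :
    HasQExpansion (Derivative.normalizedDerivOfComplex F) (theta p) := by
  intro τ
  let σ : ℍ := ⟨Complex.I * (τ.im / 2), by simpa using τ.im_pos⟩
  have hσ : (σ : ℂ) = Complex.I * (τ.im / 2) := rfl
  have hq (w : ℂ) : HasDerivAt (Function.Periodic.qParam 1)
      (2 * Real.pi * Complex.I * Function.Periodic.qParam 1 w) w := by
    have h := ((hasDerivAt_id w).const_mul (2 * Real.pi * Complex.I)).cexp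
    have he : Function.Periodic.qParam 1 = fun w => cexp (2 * Real.pi * Complex.I * w) := by
      funext w; simp [Function.Periodic.qParam]
    rw [he]
    exact h.congr_deriv (by simp only [id]; ring)
  have hd (n : ℕ) (w : ℂ) : HasDerivAt (fun w => p.coeff n * Function.Periodic.qParam 1 w ^ n)
      (2 * Real.pi * Complex.I * ((theta p).coeff n * Function.Periodic.qParam 1 w ^ n)) w := by
    refine (((hq w).pow n).const_mul (p.coeff n)).congr_deriv ?_
    rw [coeff_theta]
    cases n with
    | zero => simp
    | succ n => simp only [Nat.add_sub_cancel, pow_succ]; ring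
  have key := hasSum_deriv_of_summable_norm (U := {w : ℂ | τ.im / 2 < w.im})
    (F := fun n w => p.coeff n * Function.Periodic.qParam 1 w ^ n) (h σ).summable.norm
    (fun n w _ => (hd n w).differentiableAt.differentiableWithinAt)
    (isOpen_lt continuous_const Complex.continuous_im) (fun n w hw => by
      rw [norm_mul, norm_mul, norm_pow, norm_pow, Function.Periodic.norm_qParam,
        Function.Periodic.norm_qParam, hσ]
      refine mul_le_mul_of_nonneg_left (pow_le_pow_left₀ (Real.exp_pos _).le
        (Real.exp_le_exp.mpr ?_) n) (norm_nonneg _)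
      have : τ.im / 2 < w.im := hw
      have h2 : (Complex.I * ((τ.im : ℂ) / 2)).im = τ.im / 2 := by simp
      simp only [h2, div_one]
      nlinarith [Real.pi_pos]) (z := (τ : ℂ)) (by
      have := τ.im_pos
      simp only [Set.mem_ofPred_eq, UpperHalfPlane.coe_im]; linarith)
  have he : deriv (fun w : ℂ => ∑' n, p.coeff n * Function.Periodic.qParam 1 w ^ n) τ =
      deriv (F ∘ ofComplex) τ := by
    refine Filter.EventuallyEq.deriv_eq ?_
    filter_upwards [isOpen_upperHalfPlaneSet.mem_nhds τ.im_pos] with w hw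
    rw [Function.comp_apply, ofComplex_apply_of_im_pos hw]
    exact (h ⟨w, hw⟩).tsum_eq
  rw [he] at key
  convert! key.mul_left (2 * Real.pi * Complex.I)⁻¹ using 1
  funext n
  rw [(hd n τ).deriv, inv_mul_cancel_left₀ Complex.two_pi_I_ne_zero]

theorem HasQExpansion.isBoundedAtImInfty {F : ℍ → ℂ} {p : ℂ⟦X⟧} (h : HasQExpansion F p) :
    IsBoundedAtImInfty F :=
  isBoundedAtImInfty_of_hasSum_qExpansion one_pos h

/-- A holomorphic function of level one and weight `k < 12` is zero if its `q`-expansion has no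
constant term. -/
theorem eq_zero_of_hasQExpansion {k : ℤ} (hk : k < 12) {F : ℍ → ℂ} {p : ℂ⟦X⟧}
    (hF : MDiff F) (hslash : ∀ γ : SL(2, ℤ), F ∣[k] γ = F) (h : HasQExpansion F p)
    (h0 : p.coeff 0 = 0) : p = 0 := by
  let f : ModularForm 𝒮ℒ k :=
    { toFun := F
      slash_action_eq' := fun _ ⟨γ, hγ⟩ => hγ ▸ hslash γ
      holo' := hF
      -- Invariance reduces every cusp to infinity, where the q-expansion gives boundedness.
      bdd_at_cusps' := fun {c} hc => by
        rw [OnePoint.isBoundedAt_iff_forall_SL2Z (by simpa using hc)]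
        intro γ _
        rw [hslash γ]
        exact h.isBoundedAtImInfty }
  have hq : p = qExpansion 1 f := PowerSeries.ext fun m =>
    ModularFormClass.qExpansion_coeff_unique one_pos one_mem_strictPeriods_SL (f := f) h m
  have hf : f = 0 := ModularForm.sturm_bound_levelOne <| by
    -- The Sturm bound is 0 here (negative weights truncate to 0), so one vanishing coefficient is
    -- enough.
    have hk0 : k.toNat / 12 = 0 := by omega
    rw [hk0, ← hq]
    refine lt_of_lt_of_le (by norm_num : ((0 : ℕ) : ℕ∞) < ((1 : ℕ) : ℕ∞))
      (PowerSeries.nat_le_order _ _ fun i hi => ?_)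
    obtain rfl : i = 0 := by omega
    exact h0
  rw [hq, hf, FunLike.coe_zero, qExpansion_zero]

/-! ### Eisenstein series and Ramanujan's formulas. -/

/-- The `q`-expansion of `E₂`. -/
def P : ℂ⟦X⟧ :=
  PowerSeries.mk fun m => if m = 0 then 1 else -24 * (ArithmeticFunction.sigma 1 m : ℂ)

/-- The `q`-expansion of `E₄`. -/
def Q : ℂ⟦X⟧ := qExpansion 1 ModularForm.E₄

/-- The `q`-expansion of `E₆`. -/
def R : ℂ⟦X⟧ := qExpansion 1 ModularForm.E₆

theorem hasQExpansion_E2 : HasQExpansion EisensteinSeries.E2 P :=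
  hasQExpansion_iff_hasLaurentExpansion.mpr hasLaurentExpansion_E2

theorem hasQExpansion_E₄ : HasQExpansion ModularForm.E₄ Q := fun τ =>
  ModularForm.hasSum_qExpansion ModularForm.E₄ one_pos one_mem_strictPeriods_SL τ

theorem hasQExpansion_E₆ : HasQExpansion ModularForm.E₆ R := fun τ =>
  ModularForm.hasSum_qExpansion ModularForm.E₆ one_pos one_mem_strictPeriods_SL τ

theorem constantCoeff_P : P.constantCoeff = 1 := by simp [P]

theorem constantCoeff_Q : Q.constantCoeff = 1 :=
  (PowerSeries.coeff_zero_eq_constantCoeff_apply _).symm.trans <|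
    EisensteinSeries.E_qExpansion_coeff_zero _ ⟨2, rfl⟩

theorem constantCoeff_R : R.constantCoeff = 1 :=
  (PowerSeries.coeff_zero_eq_constantCoeff_apply _).symm.trans <|
    EisensteinSeries.E_qExpansion_coeff_zero _ ⟨3, rfl⟩

theorem slash_E₄ (γ : SL(2, ℤ)) : (⇑ModularForm.E₄ : ℍ → ℂ) ∣[(4 : ℤ)] γ = ⇑ModularForm.E₄ :=
  ModularForm.E₄.slash_action_eq' _ ⟨γ, rfl⟩

theorem slash_E₆ (γ : SL(2, ℤ)) : (⇑ModularForm.E₆ : ℍ → ℂ) ∣[(6 : ℤ)] γ = ⇑ModularForm.E₆ :=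
  ModularForm.E₆.slash_action_eq' _ ⟨γ, rfl⟩

/-- Ramanujan's formula for the derivative of `E₄`. -/
theorem theta_Q : 3 * theta Q = P * Q - R := by
  -- The Serre derivative θE₄ - E₂E₄/3 has weight 6 and constant term -1/3; adding E₆/3 cancels that
  -- term.
  have h := eq_zero_of_hasQExpansion (k := 6) (by norm_num)
    (F := Derivative.serreDerivative ((4 : ℤ) : ℂ) ModularForm.E₄ + (1 / 3 : ℂ) • ⇑ModularForm.E₆)
    (p := (theta Q - (1 / 3 : ℂ) • (P * Q)) + (1 / 3 : ℂ) • R)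
    ((Derivative.serreDerivative_mdifferentiable _ ModularForm.E₄.holo').add
      (ModularForm.E₆.holo'.const_smul _))
    (fun γ => by
      rw [SlashAction.add_slash, ModularForm.SL_smul_slash, slash_E₆]
      congr 1
      exact Derivative.serreDerivative_slash_invariant (k := 4) ModularForm.E₄.holo' (slash_E₄ γ))
    (by
      have h1 := hasQExpansion_E₄.derivative.sub
        ((hasQExpansion_E2.mul hasQExpansion_E₄).smul (1 / 3))
      refine HasQExpansion.add ?_ (hasQExpansion_E₆.smul _)
      convert! h1 using 1
      funext z
      simp
      ring)
    (by simp [constantCoeff_P, constantCoeff_Q, constantCoeff_R, theta_apply])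
  rw [PowerSeries.smul_eq_C_mul, PowerSeries.smul_eq_C_mul] at h
  have h3 : (3 : ℂ⟦X⟧) * PowerSeries.C (1 / 3 : ℂ) = 1 := by
    rw [← map_ofNat PowerSeries.C 3, ← map_mul]; norm_num
  linear_combination 3 * h + (P * Q - R) * h3

theorem hasDerivAt_D2 (γ : SL(2, ℤ)) (z : ℍ) :
    HasDerivAt (EisensteinSeries.D2 γ ∘ ofComplex)
      (-(2 * Real.pi * Complex.I)⁻¹ * EisensteinSeries.D2 γ z ^ 2) z := by
  have h := (hasDerivAt_denom_zpow (γ : GL (Fin 2) ℝ) (-1) z).const_mul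
    (2 * Real.pi * Complex.I * γ 1 0)
  refine (h.congr_of_eventuallyEq ?_).congr_deriv ?_
  · filter_upwards [isOpen_upperHalfPlaneSet.mem_nhds z.im_pos] with w hw
    rw [Function.comp_apply, ofComplex_apply_of_im_pos hw, zpow_neg_one, ← div_eq_mul_inv]
    rfl
  · have h1 := denom_ne_zero (γ : GL (Fin 2) ℝ) z
    have hp := Complex.two_pi_I_ne_zero
    have h2 : ((γ : GL (Fin 2) ℝ) 1 0 : ℂ) = γ 1 0 := by simp
    rw [EisensteinSeries.D2, h2, show (-1 - 1 : ℤ) = -2 by norm_num, zpow_neg, zpow_ofNat,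
      Int.cast_neg, Int.cast_one]
    generalize (2 * Real.pi * Complex.I : ℂ) = c at hp ⊢
    field_simp

/-- E₂ is only quasimodular: its transformation adds a multiple of `D2`. The resulting anomalies of
θE₂ and of E₂²/12 cancel, because the derivative of `D2` is a multiple of its square and ζ(2) =
π²/6. -/
theorem serreDeriv_E2_slash (γ : SL(2, ℤ)) :
    (Derivative.normalizedDerivOfComplex EisensteinSeries.E2 -
      (1 / 12 : ℂ) • (EisensteinSeries.E2 * EisensteinSeries.E2)) ∣[(4 : ℤ)] γ =
    Derivative.normalizedDerivOfComplex EisensteinSeries.E2 -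
      (1 / 12 : ℂ) • (EisensteinSeries.E2 * EisensteinSeries.E2) := by
  have hD : MDiff (EisensteinSeries.D2 γ) := fun z =>
    mdifferentiableAt_iff.mpr (hasDerivAt_D2 γ z).differentiableAt
  have hE := EisensteinSeries.E2_slash_action γ
  have hS := Derivative.normalizedDerivOfComplex_SL_slash (k := 2) E2_mdifferentiable (γ := γ)
  rw [hE, Derivative.normalizedDerivOfComplex_sub _ _ E2_mdifferentiable (hD.const_smul _),
    Derivative.normalizedDerivOfComplex_smul _ _ hD] at hS
  have hM := ModularForm.mul_slash_SL2 2 2 γ EisensteinSeries.E2 EisensteinSeries.E2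
  rw [hE] at hM
  norm_num at hS hM
  rw [sub_eq_add_neg, SlashAction.add_slash, SlashAction.neg_slash, ModularForm.SL_smul_slash, hM]
  funext z
  have hz := congrFun hS z
  have hx : (γ 1 0 : ℂ) / denom γ z =
      (2 * Real.pi * Complex.I)⁻¹ * EisensteinSeries.D2 γ z := by
    have hp := Complex.two_pi_I_ne_zero
    rw [EisensteinSeries.D2, mul_div_assoc, inv_mul_cancel_left₀ hp]
  have hp : (Real.pi : ℂ) ≠ 0 := by exact_mod_cast Real.pi_ne_zero
  have hI : Complex.I⁻¹ = -Complex.I := Complex.inv_I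
  simp only [Pi.sub_apply, Pi.add_apply, Pi.neg_apply, Pi.smul_apply, Pi.mul_apply, smul_eq_mul, hx,
    Derivative.normalizedDerivOfComplex, (hasDerivAt_D2 γ z).deriv, riemannZeta_two,
    mul_inv, hI] at hz ⊢
  field_simp at hz ⊢
  linear_combination -6 * hz + (24 * Real.pi ^ 2 * EisensteinSeries.E2 z *
    EisensteinSeries.D2 γ z - 36 * EisensteinSeries.D2 γ z ^ 2) * Complex.I_sq

/-- Ramanujan's formula for the derivative of `E₂`. -/
theorem theta_P : 12 * theta P = P ^ 2 - Q := by
  have h := eq_zero_of_hasQExpansion (k := 4) (by norm_num)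
    (F := (Derivative.normalizedDerivOfComplex EisensteinSeries.E2 -
      (1 / 12 : ℂ) • (EisensteinSeries.E2 * EisensteinSeries.E2)) +
      (1 / 12 : ℂ) • ⇑ModularForm.E₄)
    (((Derivative.normalizedDerivOfComplex_mdifferentiable E2_mdifferentiable).sub
      ((E2_mdifferentiable.mul E2_mdifferentiable).const_smul _)).add
      (ModularForm.E₄.holo'.const_smul _))
    (fun γ => by
      rw [SlashAction.add_slash, ModularForm.SL_smul_slash, slash_E₄, serreDeriv_E2_slash])
    ((hasQExpansion_E2.derivative.sub ((hasQExpansion_E2.mul hasQExpansion_E2).smul _)).add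
      (hasQExpansion_E₄.smul _))
    (by simp [constantCoeff_P, constantCoeff_Q, theta_apply])
  rw [PowerSeries.smul_eq_C_mul, PowerSeries.smul_eq_C_mul] at h
  have h3 : (12 : ℂ⟦X⟧) * PowerSeries.C (1 / 12 : ℂ) = 1 := by
    rw [← map_ofNat PowerSeries.C 12, ← map_mul]; norm_num
  linear_combination 12 * h + (P * P - Q) * h3

/-! ### The discriminant and the expansion of j. -/

/-- Δ = η²⁴, and E₂ is, up to a constant, the logarithmic derivative of η. -/
theorem normalizedDeriv_discriminant :
    Derivative.normalizedDerivOfComplex ModularForm.discriminant =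
      EisensteinSeries.E2 * ModularForm.discriminant := by
  funext z
  have hd := ModularForm.differentiableAt_eta_of_mem_upperHalfPlaneSet z.im_pos
  have hl := ModularForm.logDeriv_eta_eq_E2 z
  have h0 := ModularForm.eta_ne_zero z.im_pos
  have he : (ModularForm.discriminant ∘ ofComplex) =ᶠ[𝓝 (z : ℂ)]
      fun w => ModularForm.eta w ^ 24 := by
    filter_upwards [isOpen_upperHalfPlaneSet.mem_nhds z.im_pos] with w hw
    rw [Function.comp_apply, ofComplex_apply_of_im_pos hw]
    rfl
  rw [logDeriv_apply, div_eq_iff h0] at hl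
  rw [Derivative.normalizedDerivOfComplex, he.deriv_eq, (hd.hasDerivAt.fun_pow 24).deriv, hl,
    Pi.mul_apply, ModularForm.discriminant]
  have := Real.pi_ne_zero
  field_simp
  ring

theorem hasQExpansion_discriminant :
    HasQExpansion ModularForm.discriminant (qExpansion 1 ModularForm.discriminant) := fun τ =>
  ModularForm.hasSum_qExpansion CuspForm.discriminant one_pos one_mem_strictPeriods_SL τ

theorem theta_discriminant : theta (qExpansion 1 ModularForm.discriminant) =
    P * qExpansion 1 ModularForm.discriminant :=
  (normalizedDeriv_discriminant ▸ hasQExpansion_discriminant.derivative).unique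
    (hasQExpansion_E2.mul hasQExpansion_discriminant)

theorem discriminant_relation : 1728 * qExpansion 1 ModularForm.discriminant = Q ^ 3 - R ^ 2 := by
  have h := (hasQExpansion_E₄.mul (hasQExpansion_E₄.mul hasQExpansion_E₄)).sub
    (hasQExpansion_E₆.mul hasQExpansion_E₆)
  have h2 := hasQExpansion_discriminant.smul 1728
  have he : (1728 : ℂ) • ModularForm.discriminant =
      (⇑ModularForm.E₄ * (⇑ModularForm.E₄ * ⇑ModularForm.E₄) - ⇑ModularForm.E₆ * ⇑ModularForm.E₆
        : ℍ → ℂ) := by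
    funext z
    simp [ModularForm.discriminant_eq_E₄_cube_sub_E₆_sq]
    ring
  rw [he] at h2
  have := h2.unique h
  rw [PowerSeries.smul_eq_C_mul, map_ofNat] at this
  linear_combination this

/-- The unit `Δ / q`. -/
def deltaUnit : ℂ⟦X⟧ := PowerSeries.mk fun n => (qExpansion 1 ModularForm.discriminant).coeff (n + 1)

theorem qExpansion_discriminant : qExpansion 1 ModularForm.discriminant =
    PowerSeries.X * deltaUnit := by
  have h : (qExpansion 1 ModularForm.discriminant).constantCoeff = 0 := by
    have := ModularForm.discriminant_qExpansion_order
    rw [← PowerSeries.coeff_zero_eq_constantCoeff_apply]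
    exact PowerSeries.coeff_of_lt_order _ (by rw [this]; norm_num)
  rw [mul_comm, ← sub_zero (qExpansion 1 ModularForm.discriminant), ← map_zero PowerSeries.C, ← h]
  conv_lhs => rw [h]
  simpa [h] using! PowerSeries.sub_const_eq_shift_mul_X (qExpansion 1 ModularForm.discriminant)

theorem constantCoeff_deltaUnit : deltaUnit.constantCoeff = 1 := by
  rw [← PowerSeries.coeff_zero_eq_constantCoeff_apply, deltaUnit, PowerSeries.coeff_mk]
  exact ModularForm.discriminant_qExpansion_coeff_one

/-- The power series `r` such that `j = r / q`. -/
def jUnit : ℂ⟦X⟧ := Q ^ 3 * deltaUnit⁻¹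

theorem jUnit_mul_deltaUnit : jUnit * deltaUnit = Q ^ 3 := by
  rw [jUnit, mul_assoc, PowerSeries.inv_mul_cancel _ (by simp [constantCoeff_deltaUnit]), mul_one]

theorem constantCoeff_jUnit : jUnit.constantCoeff = 1 := by
  simp [jUnit, constantCoeff_Q, constantCoeff_deltaUnit]

/-- Some expansion `L` of j is known to exist; jΔ = E₄³ and uniqueness of expansions determine it,
since Δ is X times a unit. -/
theorem hasLaurentExpansion_jFun :
    HasLaurentExpansion jFun (HahnSeries.single (-1) (1 : ℂ) * (jUnit : ℂ⸨X⸩)) := by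
  obtain ⟨L, hL⟩ := exists_hasLaurentExpansion_jFun
  have h1 := hL.mul hasQExpansion_discriminant.hasLaurentExpansion
  have h2 := (hasQExpansion_E₄.mul (hasQExpansion_E₄.mul hasQExpansion_E₄)).hasLaurentExpansion
  have he : jFun * ModularForm.discriminant =
      ⇑ModularForm.E₄ * (⇑ModularForm.E₄ * ⇑ModularForm.E₄) := by
    funext z
    have := ModularForm.discriminant_ne_zero z
    simp only [jFun, Pi.mul_apply]
    field_simp
  rw [he] at h1
  have h3 := h1.unique h2
  rw [qExpansion_discriminant, PowerSeries.coe_mul, PowerSeries.coe_X] at h3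
  have hs : ((deltaUnit⁻¹ : ℂ⟦X⟧) : ℂ⸨X⸩) * (deltaUnit : ℂ⸨X⸩) = 1 := by
    rw [← PowerSeries.coe_mul,
      PowerSeries.inv_mul_cancel _ (by simp [constantCoeff_deltaUnit]), PowerSeries.coe_one]
  have hX : HahnSeries.single (-1 : ℤ) (1 : ℂ) * HahnSeries.single 1 1 = 1 := by simp
  have : L = HahnSeries.single (-1) (1 : ℂ) * (jUnit : ℂ⸨X⸩) := by
    rw [jUnit, pow_three, PowerSeries.coe_mul, ← h3]
    linear_combination (-L) * hs - L * ((deltaUnit⁻¹ : ℂ⟦X⟧) : ℂ⸨X⸩) * deltaUnit * hX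
  exact this ▸ hL

theorem hasLaurentExpansion_one : HasLaurentExpansion 1 1 := by
  intro τ
  convert! hasSum_single (f := fun n : ℤ => (1 : ℂ⸨X⸩).coeff n *
    Function.Periodic.qParam 1 (τ : ℂ) ^ n) 0 (fun n hn => by simp [HahnSeries.coeff_one, hn])
    using 1
  simp

theorem HasLaurentExpansion.pow {F : ℍ → ℂ} {L : ℂ⸨X⸩} (h : HasLaurentExpansion F L) (n : ℕ) :
    HasLaurentExpansion (F ^ n) (L ^ n) := by
  induction n with
  | zero => simpa using hasLaurentExpansion_one
  | succ n ih => rw [pow_succ, pow_succ]; exact ih.mul h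

/-- The moments of the Atkin inner product as coefficients of power series. -/
theorem atkinInner_jElt_pow (m : ℕ) :
    atkinInner (jElt ^ m) 1 = (jUnit ^ m * P).coeff m := by
  have h := (hasLaurentExpansion_jFun.pow m).mul hasQExpansion_E2.hasLaurentExpansion
  have he : ((jElt ^ m : PolyJ) : ℍ → ℂ) * ((1 : PolyJ) : ℍ → ℂ) * EisensteinSeries.E2 =
      jFun ^ m * EisensteinSeries.E2 := by simp [jElt]
  have hL : (HahnSeries.single (-1) (1 : ℂ) * (jUnit : ℂ⸨X⸩)) ^ m * (P : ℂ⸨X⸩) =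
      HahnSeries.single (-(m : ℤ)) (1 : ℂ) * ((jUnit ^ m * P : ℂ⟦X⟧) : ℂ⸨X⸩) := by
    rw [mul_pow, HahnSeries.single_pow, PowerSeries.coe_mul, PowerSeries.coe_pow]
    simp [mul_assoc]
  rw [atkinInner, he, h.constantTerm_eq, hL]
  have := HahnSeries.coeff_single_mul_add (r := (1 : ℂ)) (x := ((jUnit ^ m * P : ℂ⟦X⟧) : ℂ⸨X⸩))
    (a := m) (b := -(m : ℤ))
  rw [add_neg_cancel] at this
  rw [this, one_mul, LaurentSeries.coeff_coe_powerSeries]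

/-! ### The change of variable `t = 1 / j` -/

/-- The `q`-expansion of `1 / j`. -/
def tSeries : ℂ⟦X⟧ := PowerSeries.X * jUnit⁻¹

theorem jUnit_inv : jUnit * jUnit⁻¹ = 1 :=
  PowerSeries.mul_inv_cancel _ (by simp [constantCoeff_jUnit])

theorem constantCoeff_tSeries : tSeries.constantCoeff = 0 := by simp [tSeries]

theorem hasSubst_tSeries : PowerSeries.HasSubst tSeries :=
  PowerSeries.HasSubst.of_constantCoeff_zero' constantCoeff_tSeries

theorem theta_tSeries_mul (f : ℂ⟦X⟧) : theta (f.subst tSeries) =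
    (PowerSeries.derivative ℂ f).subst tSeries * theta tSeries := by
  rw [theta_apply, theta_apply, PowerSeries.derivative_subst hasSubst_tSeries]
  ring

theorem Q_ne_zero : Q ≠ 0 := fun h => by simpa [h] using constantCoeff_Q
theorem R_ne_zero : R ≠ 0 := fun h => by simpa [h] using constantCoeff_R

theorem tSeries_mul_Q : tSeries * Q ^ 3 = qExpansion 1 ModularForm.discriminant := by
  rw [qExpansion_discriminant, ← jUnit_mul_deltaUnit, tSeries]
  linear_combination PowerSeries.X * deltaUnit * jUnit_inv

/-- `1 - 1728 / j = E₆ ^ 2 / E₄ ^ 3`. -/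
theorem one_sub_tSeries_mul : (1 - 1728 * tSeries) * Q ^ 3 = R ^ 2 := by
  linear_combination -1728 * tSeries_mul_Q - discriminant_relation

theorem theta_mul (f g : ℂ⟦X⟧) : theta (f * g) = f * theta g + g * theta f := by
  simp

theorem theta_pow (f : ℂ⟦X⟧) (n : ℕ) : theta (f ^ n) = n * f ^ (n - 1) * theta f := by
  simp [mul_assoc]

/-- Logarithmic derivative of t = Δ/E₄³: θt/t = E₂ - 3 θE₄/E₄ = E₆/E₄. -/
theorem theta_tSeries : theta tSeries * Q = tSeries * R := by
  have h := congrArg theta tSeries_mul_Q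
  rw [theta_discriminant, ← tSeries_mul_Q, theta_mul, theta_pow] at h
  refine mul_right_cancel₀ (pow_ne_zero 2 Q_ne_zero) ?_
  push_cast at h
  linear_combination h - tSeries * Q ^ 2 * theta_Q

/-- Ramanujan's formula for the derivative of `E₆`. -/
theorem theta_R : 2 * theta R = P * R - Q ^ 2 := by
  -- Differentiating 1728Δ = E₄³ - E₆² gives 2 E₆ θE₆ in terms of known derivatives, so no further
  -- modularity argument is needed.
  have h := congrArg theta discriminant_relation
  rw [theta_mul, theta_discriminant, map_sub, theta_pow, theta_pow] at h
  have h0 : theta (1728 : ℂ⟦X⟧) = 0 := by simpa using theta.map_natCast 1728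
  rw [h0] at h
  refine mul_right_cancel₀ R_ne_zero ?_
  push_cast at h
  norm_num at h
  linear_combination h - P * discriminant_relation + Q ^ 2 * theta_Q

/-- Euler's operator `D = j⁻¹ d/d(j⁻¹) = (E₄ / E₆) q d/dq`. -/
def eulerOp : Derivation ℂ ℂ⟦X⟧ ℂ⟦X⟧ := (Q * R⁻¹) • theta

theorem R_inv : R * R⁻¹ = 1 := PowerSeries.mul_inv_cancel _ (by simp [constantCoeff_R])

theorem eulerOp_apply (f : ℂ⟦X⟧) : eulerOp f = Q * R⁻¹ * theta f := rfl

/-- Chain rule with θt = t E₆/E₄: this carries differential equations in t over to series in q. -/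
theorem eulerOp_subst (f : ℂ⟦X⟧) :
    eulerOp (f.subst tSeries) = (theta f).subst tSeries := by
  rw [eulerOp_apply, theta_tSeries_mul, theta_apply f, PowerSeries.subst_mul hasSubst_tSeries,
    PowerSeries.subst_X hasSubst_tSeries]
  linear_combination (PowerSeries.derivative ℂ f).subst tSeries * (R⁻¹ * theta_tSeries +
    tSeries * R_inv)

/-! ### Uniqueness for first-order equations. -/

/-- Solutions of `X f' = f A` and `X g' = g B` with equal constant terms agree up to order `d` if
`A` and `B` do. -/
theorem coeff_eq_of_theta_eq {f g A B : ℂ⟦X⟧} (hf : theta f = f * A) (hg : theta g = g * B)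
    (h0 : f.coeff 0 = g.coeff 0) (hA : A.coeff 0 = 0) {d : ℕ}
    (hAB : ∀ n ≤ d, A.coeff n = B.coeff n) : ∀ n ≤ d, f.coeff n = g.coeff n := by
  intro n
  induction n using Nat.strong_induction_on with | _ n ih =>
  intro hn
  rcases Nat.eq_zero_or_pos n with rfl | hpos
  · exact h0
  have h1 := congrArg (PowerSeries.coeff n) hf
  have h2 := congrArg (PowerSeries.coeff n) hg
  rw [coeff_theta, PowerSeries.coeff_mul] at h1 h2
  have h3 : ∑ p ∈ Finset.HasAntidiagonal.antidiagonal n, f.coeff p.1 * A.coeff p.2 =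
      ∑ p ∈ Finset.HasAntidiagonal.antidiagonal n, g.coeff p.1 * B.coeff p.2 := by
    refine Finset.sum_congr rfl fun p hp => ?_
    have hp' := Finset.HasAntidiagonal.mem_antidiagonal.mp hp
    rw [← hAB p.2 (by omega)]
    -- The term containing the unknown coefficient n is killed by A₀ = 0; all others involve lower
    -- coefficients.
    rcases Nat.eq_zero_or_pos p.2 with hz | hz
    · simp only [hz, hA, mul_zero]
    · rw [ih p.1 (by omega) (by omega)]
  have hn0 : (n : ℂ) ≠ 0 := by exact_mod_cast hpos.ne'
  exact mul_left_cancel₀ hn0 (by rw [h1, h2, h3])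

theorem eq_of_theta_eq {f g A : ℂ⟦X⟧} (hf : theta f = f * A) (hg : theta g = g * A)
    (h0 : f.coeff 0 = g.coeff 0) (hA : A.coeff 0 = 0) : f = g :=
  PowerSeries.ext fun n => coeff_eq_of_theta_eq hf hg h0 hA (d := n) (fun _ _ => rfl) n le_rfl

/-- The Riccati equation attached to the hypergeometric equation has at most one solution without
constant term. -/
theorem riccati_unique {u v z : ℂ⟦X⟧} (hz : z.constantCoeff = 0) (hu0 : u.constantCoeff = 0)
    (hv0 : v.constantCoeff = 0) {a b : ℂ⟦X⟧}
    (hu : (1 - z) * (eulerOp u + u ^ 2) = z * (a * u + b))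
    (hv : (1 - z) * (eulerOp v + v ^ 2) = z * (a * v + b)) : u = v := by
  have h1z : (1 - z) * (1 - z)⁻¹ = 1 := PowerSeries.mul_inv_cancel _ (by simp [hz])
  have hQ : Q * Q⁻¹ = 1 := PowerSeries.mul_inv_cancel _ (by simp [constantCoeff_Q])
  -- The difference of two Riccati solutions satisfies a linear equation whose coefficient has no
  -- constant term, as does 0.
  have key : theta (u - v) = (u - v) * (R * Q⁻¹ * ((1 - z)⁻¹ * z * a - (u + v))) := by
    rw [eulerOp_apply] at hu hv
    rw [map_sub]
    have h := congrArg (fun x => (1 - z)⁻¹ * R * Q⁻¹ * x) (congrArg₂ (· - ·) hu hv)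
    beta_reduce at h
    linear_combination h - ((Q * Q⁻¹ * (R * R⁻¹)) * (theta u - theta v) +
      (R * Q⁻¹) * (u ^ 2 - v ^ 2)) * h1z - (theta u - theta v) * (R * R⁻¹ * hQ + R_inv)
  have h0 : theta (0 : ℂ⟦X⟧) = 0 * (R * Q⁻¹ * ((1 - z)⁻¹ * z * a - (u + v))) := by simp
  exact sub_eq_zero.mp (eq_of_theta_eq key h0 (by simp [hu0, hv0]) (by simp [hu0, hv0, hz]))

/-! ### The hypergeometric equation -/

theorem coeff_F₁ (n : ℕ) :
    F₁.coeff n = 1728 ^ n * ordinaryHypergeometricCoefficient (1 / 12 : ℂ) (5 / 12) 1 n := by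
  simp [F₁, hypergeometric, PowerSeries.coeff_rescale]

theorem constantCoeff_F₁ : F₁.constantCoeff = 1 := by
  rw [← PowerSeries.coeff_zero_eq_constantCoeff_apply, coeff_F₁]
  simp [ordinaryHypergeometricCoefficient]

theorem coeff_F₁_succ (n : ℕ) : ((n : ℂ) + 1) ^ 2 * F₁.coeff (n + 1) =
    1728 * ((1 / 12 + n) * (5 / 12 + n)) * F₁.coeff n := by
  rw [coeff_F₁, coeff_F₁]
  have h1 : ((ascPochhammer ℂ n).eval 1) ≠ 0 := by
    rw [ascPochhammer_eval_one]; exact_mod_cast n.factorial_ne_zero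
  have h2 : (n.factorial : ℂ) ≠ 0 := by exact_mod_cast n.factorial_ne_zero
  have h3 : (n : ℂ) + 1 ≠ 0 := by exact_mod_cast n.succ_ne_zero
  have h4 : 1 + (n : ℂ) ≠ 0 := by rwa [add_comm]
  simp only [ordinaryHypergeometricCoefficient, ascPochhammer_succ_eval, Nat.factorial_succ,
    Nat.cast_mul, Nat.cast_add, Nat.cast_one, mul_inv, pow_succ]
  field_simp
  ring

/-- Coefficientwise this is the recursion `coeff_F₁_succ`, as (n + 1/12)(n + 5/12) = n² + n/2 +
5/144. -/
theorem hypergeometric_equation : theta (theta F₁) = 1728 * PowerSeries.X *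
    (theta (theta F₁) + PowerSeries.C (1 / 2) * theta F₁ + PowerSeries.C (5 / 144) * F₁) := by
  ext n
  have h1728 : (1728 : ℂ⟦X⟧) = PowerSeries.C 1728 := (map_ofNat PowerSeries.C 1728).symm
  rw [h1728, mul_assoc, PowerSeries.coeff_C_mul, coeff_theta, coeff_theta]
  cases n with
  | zero => simp
  | succ n =>
    rw [PowerSeries.coeff_succ_X_mul, map_add, map_add, PowerSeries.coeff_C_mul,
      PowerSeries.coeff_C_mul, coeff_theta, coeff_theta]
    push_cast
    linear_combination coeff_F₁_succ n

/-- The logarithmic derivative `t F₁'(t) / F₁(t)`. -/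
def logDerivF₁ : ℂ⟦X⟧ := theta F₁ * F₁⁻¹

theorem F₁_inv : F₁ * F₁⁻¹ = 1 := PowerSeries.mul_inv_cancel _ (by simp [constantCoeff_F₁])

theorem theta_F₁ : theta F₁ = F₁ * logDerivF₁ := by
  rw [logDerivF₁]
  linear_combination -theta F₁ * F₁_inv

theorem constantCoeff_logDerivF₁ : logDerivF₁.constantCoeff = 0 := by
  simp [logDerivF₁, theta_apply]

/-- With θF₁ = F₁v one has θ²F₁ = F₁(θv + v²), and F₁ cancels from the hypergeometric equation. -/
theorem logDerivF₁_riccati : (1 - 1728 * PowerSeries.X) * (theta logDerivF₁ + logDerivF₁ ^ 2) =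
    1728 * PowerSeries.X * (PowerSeries.C (1 / 2) * logDerivF₁ + PowerSeries.C (5 / 144)) := by
  have h := hypergeometric_equation
  have hF : F₁ ≠ 0 := fun h => by simpa [h] using constantCoeff_F₁
  rw [theta_F₁, theta_mul, theta_F₁] at h
  refine mul_left_cancel₀ hF ?_
  linear_combination h

theorem logDerivF₁_subst_riccati :
    (1 - 1728 * tSeries) * (eulerOp (logDerivF₁.subst tSeries) + logDerivF₁.subst tSeries ^ 2) =
    1728 * tSeries * (PowerSeries.C (1 / 2) * logDerivF₁.subst tSeries +
      PowerSeries.C (5 / 144)) := by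
  have h := congrArg (PowerSeries.substAlgHom hasSubst_tSeries) logDerivF₁_riccati
  have hC (c : ℂ) : (PowerSeries.C c : ℂ⟦X⟧).subst tSeries = PowerSeries.C c :=
    PowerSeries.subst_C c
  simp only [map_mul, map_add, map_sub, map_pow, map_one, map_ofNat,
    PowerSeries.coe_substAlgHom, PowerSeries.subst_X hasSubst_tSeries, hC, ← eulerOp_subst] at h
  exact h

theorem E2_riccati {u : ℂ⟦X⟧} (hu : 12 * u * R = P * Q - R) :
    (1 - 1728 * tSeries) * (eulerOp u + u ^ 2) =
    1728 * tSeries * (PowerSeries.C (1 / 2) * u + PowerSeries.C (5 / 144)) := by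
  have h2 : 2 * (PowerSeries.C (1 / 2 : ℂ) : ℂ⟦X⟧) = 1 := by
    rw [← map_ofNat PowerSeries.C 2, ← map_mul]; norm_num
  have h144 : 144 * (PowerSeries.C (5 / 144 : ℂ) : ℂ⟦X⟧) = 5 := by
    rw [← map_ofNat PowerSeries.C 144, ← map_ofNat PowerSeries.C 5, ← map_mul]; norm_num
  have hd := congrArg theta hu
  have h0 : theta (12 : ℂ⟦X⟧) = 0 := by exact_mod_cast theta.map_natCast 12
  rw [theta_mul, theta_mul, map_sub, theta_mul, h0] at hd
  have hc : (144 * Q ^ 3 * R : ℂ⟦X⟧) ≠ 0 := by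
    refine mul_ne_zero (mul_ne_zero ?_ (pow_ne_zero _ Q_ne_zero)) R_ne_zero
    intro h
    have := congrArg (constantCoeff (R := ℂ)) h
    rw [map_ofNat, map_zero] at this
    norm_num at this
  refine mul_left_cancel₀ hc ?_
  have ht : 1728 * tSeries * Q ^ 3 = Q ^ 3 - R ^ 2 := by
    linear_combination -one_sub_tSeries_mul
  have he : R * eulerOp u = Q * theta u := by
    rw [eulerOp_apply]; linear_combination Q * theta u * R_inv
  -- The Riccati equation times 144 Q³R, with 1 - 1728t = R²/Q³ inserted: a consequence of
  -- Ramanujan's three formulas and `hu`.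
  have main : 144 * (R ^ 3 * (eulerOp u + u ^ 2)) = (Q ^ 3 - R ^ 2) * R * (72 * u + 5) := by
    linear_combination 144 * R ^ 2 * he + 12 * R * Q * hd - 12 * Q * theta R * hu +
      4 * R * Q * P * theta_Q + R * Q ^ 2 * theta_P - 6 * P * Q ^ 2 * theta_R +
      R * (12 * u * R + P * Q - R) * hu - 6 * (Q ^ 3 - R ^ 2) * hu
  linear_combination main + 144 * R * (eulerOp u + u ^ 2) * one_sub_tSeries_mul -
    144 * R * (PowerSeries.C (1 / 2) * u + PowerSeries.C (5 / 144)) * ht -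
    (Q ^ 3 - R ^ 2) * R * (72 * u * h2 + h144)

/-- The formula `12 t F₁'(t) / F₁(t) = E₂ E₄ / E₆ - 1` at `t = 1 / j`. -/
theorem logDerivF₁_subst : R * (1 + 12 * logDerivF₁.subst tSeries) = P * Q := by
  have h12 : 12 * (PowerSeries.C (1 / 12 : ℂ) : ℂ⟦X⟧) = 1 := by
    rw [← map_ofNat PowerSeries.C 12, ← map_mul]; norm_num
  let u : ℂ⟦X⟧ := PowerSeries.C (1 / 12) * (P * Q - R) * R⁻¹
  have hu : 12 * u * R = P * Q - R := by
    linear_combination (P * Q - R) * R * R⁻¹ * h12 + (P * Q - R) * R_inv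
  have h := riccati_unique (z := 1728 * tSeries) (by rw [map_mul, constantCoeff_tSeries, mul_zero])
    (by simp [u, constantCoeff_P, constantCoeff_Q, constantCoeff_R])
    (PowerSeries.constantCoeff_subst_eq_zero constantCoeff_tSeries _ constantCoeff_logDerivF₁)
    (E2_riccati hu) logDerivF₁_subst_riccati
  rw [← h]
  linear_combination hu

/-! ### Residues -/

/-- For j = r/q one has r - θr = -q θj, so this says -θj/j = E₆/E₄. -/
theorem theta_jUnit : Q * (jUnit - theta jUnit) = R * jUnit := by
  have hX : tSeries * jUnit = PowerSeries.X := by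
    rw [tSeries]; linear_combination PowerSeries.X * jUnit_inv
  have h := congrArg theta hX
  rw [theta_mul, theta_apply PowerSeries.X, PowerSeries.derivative_X, mul_one, ← hX] at h
  refine mul_left_cancel₀ (fun h0 => PowerSeries.X_ne_zero (R := ℂ) ?_ : tSeries ≠ 0) ?_
  · rw [← hX, h0, zero_mul]
  · linear_combination jUnit * theta_tSeries - Q * h

/-- The coefficient is the constant term of -j^(n-1) θj = -θ(j^n)/n, and an exact differential has
no residue. -/
theorem coeff_jUnit_pow_mul {n : ℕ} (hn : n ≠ 0) :
    (jUnit ^ (n - 1) * (jUnit - theta jUnit)).coeff n = 0 := by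
  have hn0 : (n : ℂ) ≠ 0 := by exact_mod_cast hn
  have h : (n : ℂ⟦X⟧) * (jUnit ^ (n - 1) * (jUnit - theta jUnit)) =
      n * jUnit ^ n - theta (jUnit ^ n) := by
    obtain ⟨k, rfl⟩ := Nat.exists_eq_succ_of_ne_zero hn
    rw [theta_pow, Nat.succ_sub_one, pow_succ]
    ring
  have hc : (n : ℂ⟦X⟧) = PowerSeries.C (n : ℂ) := (map_natCast PowerSeries.C n).symm
  have h2 := congrArg (PowerSeries.coeff n) h
  rw [hc, PowerSeries.coeff_C_mul, map_sub, PowerSeries.coeff_C_mul, coeff_theta, sub_self] at h2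
  exact (mul_eq_zero.mp h2).resolve_left hn0

/-- This is the constant term of -j^(m-1-k) θj: exact for k < m, and equal to -θj/j = 1 + O(q) for k
= m. -/
theorem coeff_residue_pow {m k : ℕ} (hm : m ≠ 0) (hk : k ≤ m) :
    (jUnit ^ (m - 1) * (jUnit - theta jUnit) * tSeries ^ k).coeff m = if k = m then 1 else 0 := by
  have hi (i : ℕ) : jUnit ^ i * jUnit⁻¹ ^ i = 1 := by rw [← mul_pow, jUnit_inv, one_pow]
  split_ifs with h
  · subst h
    have : jUnit ^ (k - 1) * (jUnit - theta jUnit) * tSeries ^ k =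
        PowerSeries.X ^ k * (jUnit ^ (k - 1) * (jUnit - theta jUnit) * jUnit⁻¹ ^ k) := by
      rw [tSeries]; ring
    rw [this, PowerSeries.coeff_X_pow_mul', if_pos le_rfl, Nat.sub_self]
    simp [constantCoeff_jUnit, theta_apply]
  · obtain ⟨n, rfl⟩ := Nat.exists_eq_add_of_le hk
    have hn : n ≠ 0 := by omega
    have : jUnit ^ (k + n - 1) * (jUnit - theta jUnit) * tSeries ^ k =
        PowerSeries.X ^ k * (jUnit ^ (n - 1) * (jUnit - theta jUnit)) := by
      rw [tSeries, show k + n - 1 = k + (n - 1) by omega, pow_add, mul_pow]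
      linear_combination PowerSeries.X ^ k * (jUnit ^ (n - 1) * (jUnit - theta jUnit)) * hi k
    rw [this, PowerSeries.coeff_X_pow_mul', if_pos hk, Nat.add_sub_cancel_left,
      coeff_jUnit_pow_mul hn]

/-- Change of variable in a residue: the coefficient of `t ^ m` in `B` as a residue in `q`. -/
theorem coeff_residue {m : ℕ} (hm : m ≠ 0) (B : ℂ⟦X⟧) :
    (jUnit ^ (m - 1) * (jUnit - theta jUnit) * B.subst tSeries).coeff m = B.coeff m := by
  -- The tail of B contributes a multiple of X^(m+1), invisible in degree m; what remains is a
  -- finite sum of powers of t.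
  have hB := PowerSeries.eq_X_pow_mul_shift_add_trunc (m + 1) B
  set C := PowerSeries.mk fun i => B.coeff (i + (m + 1)) with hC
  have hS : B.subst tSeries = tSeries ^ (m + 1) * C.subst tSeries +
      ∑ k ∈ Finset.range (m + 1), PowerSeries.C (B.coeff k) * tSeries ^ k := by
    conv_lhs => rw [hB]
    rw [PowerSeries.subst_add hasSubst_tSeries, PowerSeries.subst_mul hasSubst_tSeries,
      PowerSeries.subst_pow hasSubst_tSeries, PowerSeries.subst_X hasSubst_tSeries,
      PowerSeries.subst_coe hasSubst_tSeries]
    congr 1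
    rw [Polynomial.aeval_eq_sum_range' (PowerSeries.natDegree_trunc_lt B m)]
    refine Finset.sum_congr rfl fun k hk => ?_
    rw [PowerSeries.coeff_trunc, if_pos (Finset.mem_range.mp hk), PowerSeries.smul_eq_C_mul]
  rw [hS, mul_add, map_add, Finset.mul_sum, map_sum]
  have h1 : jUnit ^ (m - 1) * (jUnit - theta jUnit) * (tSeries ^ (m + 1) * C.subst tSeries) =
      PowerSeries.X ^ (m + 1) * (jUnit ^ (m - 1) * (jUnit - theta jUnit) *
        (jUnit⁻¹ ^ (m + 1) * C.subst tSeries)) := by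
    rw [tSeries]; ring
  rw [h1, PowerSeries.coeff_X_pow_mul', if_neg (by omega), zero_add,
    Finset.sum_eq_single_of_mem m (by simp)]
  · rw [mul_left_comm, PowerSeries.coeff_C_mul, coeff_residue_pow hm le_rfl, if_pos rfl, mul_one]
  · intro k hk hkm
    have := Finset.mem_range.mp hk
    rw [mul_left_comm, PowerSeries.coeff_C_mul, coeff_residue_pow hm (by omega), if_neg hkm,
      mul_zero]

/-- The moments of the Atkin inner product are the coefficients of `12 t F₁'(t) / F₁(t)`. -/
theorem atkinInner_eq {m : ℕ} (hm : m ≠ 0) :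
    atkinInner (jElt ^ m) 1 = 12 * logDerivF₁.coeff m := by
  -- Combines E₂ = (E₆/E₄)(1 + 12 v(t)) with r E₆/E₄ = r - θr. One factor r is used up, so m ≠ 0 is
  -- required.
  have h : jUnit ^ m * P = jUnit ^ (m - 1) * (jUnit - theta jUnit) *
      (1 + 12 * logDerivF₁).subst tSeries := by
    have hs : (1 + 12 * logDerivF₁).subst tSeries = 1 + 12 * logDerivF₁.subst tSeries := by
      simp only [← PowerSeries.coe_substAlgHom hasSubst_tSeries, map_add, map_mul, map_one,
        map_ofNat]
    refine mul_left_cancel₀ Q_ne_zero ?_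
    obtain ⟨k, rfl⟩ := Nat.exists_eq_succ_of_ne_zero hm
    rw [hs, Nat.succ_sub_one, pow_succ]
    linear_combination -jUnit ^ k * jUnit * logDerivF₁_subst -
      jUnit ^ k * (1 + 12 * logDerivF₁.subst tSeries) * theta_jUnit
  have h12 : (12 : ℂ⟦X⟧) = PowerSeries.C 12 := (map_ofNat PowerSeries.C 12).symm
  rw [atkinInner_jElt_pow, h, coeff_residue hm, h12, map_add, PowerSeries.coeff_C_mul,
    PowerSeries.coeff_one, if_neg hm, zero_add]

/-! ### The exponential and the product -/

/-- Both sides solve θf = f v with constant term 1: θ multiplies the m-th coefficient by m and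
undoes the division by m. The value 0 at m = 0 makes the substitution into exp legitimate. -/
theorem F₁_eq_exp : F₁ = (PowerSeries.exp ℂ).subst (PowerSeries.mk fun m : ℕ =>
    if m = 0 then 0 else 1 / 12 * atkinInner (jElt ^ m) 1 / (m : ℂ)) := by
  set S : ℂ⟦X⟧ := PowerSeries.mk fun m : ℕ =>
    if m = 0 then 0 else 1 / 12 * atkinInner (jElt ^ m) 1 / (m : ℂ) with hS
  have hS0 : S.constantCoeff = 0 := by
    rw [← PowerSeries.coeff_zero_eq_constantCoeff_apply]; simp [hS]
  have hsub : PowerSeries.HasSubst S := PowerSeries.HasSubst.of_constantCoeff_zero' hS0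
  have hA0 : logDerivF₁.coeff 0 = 0 := by simp [constantCoeff_logDerivF₁]
  have hθ : theta S = logDerivF₁ := by
    ext m
    rw [coeff_theta, hS, PowerSeries.coeff_mk]
    split_ifs with h
    · rw [h, hA0, mul_zero]
    · have : (m : ℂ) ≠ 0 := by exact_mod_cast h
      rw [atkinInner_eq h]
      field_simp
  have he : theta ((PowerSeries.exp ℂ).subst S) = (PowerSeries.exp ℂ).subst S * logDerivF₁ := by
    rw [← hθ, theta_apply, theta_apply, PowerSeries.derivative_subst hsub,
      PowerSeries.derivative_exp]
    ring
  refine eq_of_theta_eq theta_F₁ he ?_ hA0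
  -- exp - 1 has no constant term, hence neither has its composite with `S`.
  have h1 : ((PowerSeries.exp ℂ).subst S - 1).constantCoeff = 0 := by
    have := PowerSeries.constantCoeff_subst_eq_zero hS0 (PowerSeries.exp ℂ - 1) (by simp)
    rwa [PowerSeries.subst_sub hsub, ← PowerSeries.coe_substAlgHom hsub, map_one,
      PowerSeries.coe_substAlgHom hsub] at this
  rw [map_sub, map_one, sub_eq_zero] at h1
  rw [PowerSeries.coeff_zero_eq_constantCoeff_apply, PowerSeries.coeff_zero_eq_constantCoeff_apply,
    constantCoeff_F₁]
  exact h1.symm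

/-- The series `X ^ n / (1 - X ^ n) = ∑ X ^ k` over the positive multiples `k` of `n`. -/
def multiplesSeries (n : ℕ) : ℂ⟦X⟧ := PowerSeries.mk fun k => if k ≠ 0 ∧ n ∣ k then 1 else 0

theorem one_sub_mul_multiplesSeries {n : ℕ} (hn : n ≠ 0) :
    (1 - PowerSeries.X ^ n) * multiplesSeries n = PowerSeries.X ^ n := by
  ext k
  rw [sub_mul, one_mul, map_sub, PowerSeries.coeff_X_pow_mul', PowerSeries.coeff_X_pow,
    multiplesSeries, PowerSeries.coeff_mk, PowerSeries.coeff_mk]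
  rcases lt_trichotomy k n with h | h | h
  · have : ¬ (k ≠ 0 ∧ n ∣ k) := fun h2 => absurd (Nat.le_of_dvd (by omega) h2.2) (by omega)
    rw [if_neg this, if_neg (by omega), if_neg (by omega), sub_zero]
  · subst h
    simp [hn]
  · rw [if_pos h.le, if_neg h.ne']
    have : (k ≠ 0 ∧ n ∣ k) ↔ (k - n ≠ 0 ∧ n ∣ k - n) := by
      rw [Nat.dvd_sub_self_right]
      constructor
      · rintro ⟨_, h2⟩; exact ⟨by omega, Or.inl h2⟩
      · rintro ⟨_, h2⟩; exact ⟨by omega, h2.resolve_right (by omega)⟩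
    simp only [this, sub_self]

theorem one_add_X_mul_derivative_binomialSeries (a : ℂ) :
    (1 + PowerSeries.X) * PowerSeries.derivative ℂ (PowerSeries.binomialSeries ℂ a) =
      PowerSeries.C a * PowerSeries.binomialSeries ℂ a := by
  have hs (n : ℕ) : Ring.choose a (n + 1) * (n + 1) = Ring.choose a n * (a - n) := by
    have h := Ring.choose_smul_choose a (Nat.le_succ n)
    simpa [Ring.choose_one_right, mul_comm] using h
  ext n
  rw [add_mul, one_mul, map_add, PowerSeries.coeff_C_mul]
  cases n with
  | zero =>
    simp [PowerSeries.coeff_derivative]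
  | succ n =>
    rw [PowerSeries.coeff_succ_X_mul, PowerSeries.coeff_derivative, PowerSeries.coeff_derivative]
    simp only [PowerSeries.binomialSeries_coeff, smul_eq_mul, mul_one]
    have := hs (n + 1)
    push_cast at this ⊢
    linear_combination this

/-- The logarithmic derivative of (1 - t^n)^a is -n a t^n/(1 - t^n), obtained from the equation (1 +
X) f' = a f of the binomial series. -/
theorem theta_oneSubPow (n : ℕ+) (a : ℂ) : theta (oneSubPow n a) =
    oneSubPow n a * (PowerSeries.C (-(n * a)) * multiplesSeries n) := by
  have hn : (n : ℕ) ≠ 0 := n.ne_zero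
  have hsub : PowerSeries.HasSubst (-(PowerSeries.X ^ (n : ℕ)) : ℂ⟦X⟧) :=
    PowerSeries.HasSubst.of_constantCoeff_zero' (by simp [hn])
  have h := congrArg (PowerSeries.substAlgHom hsub) (one_add_X_mul_derivative_binomialSeries a)
  have hC : (PowerSeries.C a : ℂ⟦X⟧).subst (-(PowerSeries.X ^ (n : ℕ)) : ℂ⟦X⟧) =
    PowerSeries.C a := PowerSeries.subst_C a
  simp only [map_mul, map_add, map_one, PowerSeries.coe_substAlgHom, PowerSeries.subst_X hsub,
    hC] at h
  have hθ : theta (-(PowerSeries.X ^ (n : ℕ)) : ℂ⟦X⟧) =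
      -(((n : ℕ) : ℂ⟦X⟧) * PowerSeries.X ^ (n : ℕ)) := by
    obtain ⟨k, hk⟩ := Nat.exists_eq_succ_of_ne_zero hn
    rw [map_neg, theta_pow, theta_apply, PowerSeries.derivative_X, hk, Nat.succ_sub_one, pow_succ]
    ring
  have hl : theta (oneSubPow n a) = (PowerSeries.derivative ℂ
      (PowerSeries.binomialSeries ℂ a)).subst (-(PowerSeries.X ^ (n : ℕ)) : ℂ⟦X⟧) *
      theta (-(PowerSeries.X ^ (n : ℕ)) : ℂ⟦X⟧) := by
    rw [oneSubPow, theta_apply, theta_apply, PowerSeries.derivative_subst hsub]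
    ring
  have h0 : (1 - PowerSeries.X ^ (n : ℕ) : ℂ⟦X⟧) ≠ 0 := fun h0 => by
    simpa [hn] using congrArg (constantCoeff (R := ℂ)) h0
  refine mul_left_cancel₀ h0 ?_
  rw [hl, hθ, map_neg, map_mul, map_natCast]
  rw [← oneSubPow] at h
  linear_combination (-((n : ℕ) : ℂ⟦X⟧) * PowerSeries.X ^ (n : ℕ)) * h +
    ((n : ℕ) : ℂ⟦X⟧) * PowerSeries.C a * oneSubPow n a * one_sub_mul_multiplesSeries hn

theorem constantCoeff_oneSubPow (n : ℕ+) (a : ℂ) : (oneSubPow n a).constantCoeff = 1 := by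
  have hn : (n : ℕ) ≠ 0 := n.ne_zero
  have h0 : (-(PowerSeries.X ^ (n : ℕ)) : ℂ⟦X⟧).constantCoeff = 0 := by simp [hn]
  have hsub := PowerSeries.HasSubst.of_constantCoeff_zero' h0
  have := PowerSeries.constantCoeff_subst_eq_zero h0 (PowerSeries.binomialSeries ℂ a - 1) (by simp)
  rw [PowerSeries.subst_sub hsub, ← PowerSeries.coe_substAlgHom hsub, map_one,
    PowerSeries.coe_substAlgHom hsub, ← oneSubPow, map_sub, sub_eq_zero] at this
  exact this.trans (map_one _)

theorem theta_prod {ι : Type*} (s : Finset ι) {f A : ι → ℂ⟦X⟧}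
    (h : ∀ i, theta (f i) = f i * A i) :
    theta (∏ i ∈ s, f i) = (∏ i ∈ s, f i) * ∑ i ∈ s, A i := by
  classical
  induction s using Finset.induction_on with
  | empty => simp
  | insert i s hi ih =>
    rw [Finset.prod_insert hi, Finset.sum_insert hi, theta_mul, ih, h]
    ring

theorem natCast_mul_atkinExponent (n : ℕ+) : (n : ℂ) * atkinExponent n =
    ∑ d ∈ (n : ℕ).divisors,
      (ArithmeticFunction.moebius ((n : ℕ) / d) : ℂ) * logDerivF₁.coeff d := by
  have hn : (n : ℂ) ≠ 0 := by exact_mod_cast n.ne_zero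
  rw [atkinExponent, ← mul_assoc, Finset.mul_sum]
  refine Finset.sum_congr rfl fun d hd => ?_
  rw [atkinInner_eq (Nat.pos_of_mem_divisors hd).ne']
  field_simp

theorem sum_divisors_sum_moebius (A : ℕ → ℂ) {k : ℕ} (hk : 0 < k) :
    ∑ n ∈ k.divisors, ∑ d ∈ n.divisors, (ArithmeticFunction.moebius (n / d) : ℂ) * A d = A k := by
  refine ArithmeticFunction.sum_eq_iff_sum_mul_moebius_eq.mpr (fun n _ => ?_) k hk
  exact Nat.sum_divisorsAntidiagonal' fun x y => (ArithmeticFunction.moebius x : ℂ) * A y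

/-- The logarithmic derivative of a finite subproduct is ∑ n c(n) t^n/(1 - t^n). Its k-th
coefficient sums n c(n) over the divisors n of k in `s`; once all divisors occur, Möbius inversion
gives v_k. -/
theorem hasFormalProd_oneSubPow :
    HasFormalProd (fun n : ℕ+ => oneSubPow n (-atkinExponent n)) F₁ := by
  intro d
  -- `Nat.succPNat d` is d + 1, a positive bound even for d = 0; the interval contains every divisor
  -- of each positive k ≤ d.
  filter_upwards [eventually_ge_atTop (Finset.Icc 1 (Nat.succPNat d))] with s hs
  have hm0 (n : ℕ) : (multiplesSeries n).constantCoeff = 0 := by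
    rw [← PowerSeries.coeff_zero_eq_constantCoeff_apply, multiplesSeries, PowerSeries.coeff_mk]
    simp
  have h := theta_prod s fun n : ℕ+ => theta_oneSubPow n (-atkinExponent n)
  refine coeff_eq_of_theta_eq h theta_F₁ ?_ ?_ (d := d) (fun k hk => ?_) d le_rfl
  · simp only [PowerSeries.coeff_zero_eq_constantCoeff_apply, map_prod, constantCoeff_oneSubPow,
      Finset.prod_const_one, constantCoeff_F₁]
  · simp [hm0]
  · rcases Nat.eq_zero_or_pos k with rfl | hk0
    · simp [hm0, constantCoeff_logDerivF₁]
    · rw [← sum_divisors_sum_moebius (fun d => logDerivF₁.coeff d) hk0, map_sum]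
      have hdiv : k.divisors = (s.map ⟨PNat.val, PNat.coe_injective⟩).filter (· ∣ k) := by
        ext i
        simp only [Nat.mem_divisors, Finset.mem_filter, Finset.mem_map,
          Function.Embedding.coeFn_mk]
        constructor
        · rintro ⟨hi, _⟩
          have hi0 := Nat.pos_of_dvd_of_pos hi hk0
          refine ⟨⟨⟨i, hi0⟩, hs (Finset.mem_Icc.mpr ⟨one_le, ?_⟩), rfl⟩, hi⟩
          have := Nat.le_of_dvd hk0 hi
          exact PNat.coe_le_coe _ _ |>.mp (by simp; omega)
        · rintro ⟨_, hi⟩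
          exact ⟨hi, hk0.ne'⟩
      rw [hdiv, Finset.sum_filter, Finset.sum_map]
      refine Finset.sum_congr rfl fun n _ => ?_
      simp only [Function.Embedding.coeFn_mk]
      rw [← natCast_mul_atkinExponent, PowerSeries.coeff_C_mul, multiplesSeries,
        PowerSeries.coeff_mk]
      simp [hk0.ne']

end AtkinProduct

end

theorem mainTheorem9 :
    AtkinProduct.HasFormalProd
        (fun n : ℕ+ => AtkinProduct.oneSubPow n (-AtkinProduct.atkinExponent n))
        AtkinProduct.F₁ ∧
      AtkinProduct.F₁ =
        (PowerSeries.exp ℂ).subst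
          (PowerSeries.mk fun m : ℕ =>
            if m = 0 then 0
            else 1 / 12 * AtkinProduct.atkinInner (AtkinProduct.jElt ^ m) 1 / (m : ℂ)) :=
  ⟨AtkinProduct.hasFormalProd_oneSubPow, AtkinProduct.F₁_eq_exp⟩
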